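/- Let $G$ be a finite group, $R$ a field, and $\mathcal P$ a finite $G$-poset (a finite partially ordered set on which $G$ acts by order-preserving maps). For a finite group $H$ write $G_0(RH)$ for the Grothendieck group of finitely generated $RH$-modules, with one relation $[M]=[L]+[N]$ for each short exact sequence $0\to L\to M\to N\to 0$, and $G_0^{st}(RH)$ for the Grothendieck group of the triangulated stable module category $\underline{\mathrm{mod}}\text{-}RH$ (finitely generated modules, morphisms modulo those that factor through a projective module). For a subgroup $H\le G$, induction $M\mapsto M\uparrow_H^G=M\otimes_{RH}RG$ gives homomorphisms $G_0(RH)\to G_0(RG)$ and $G_0^{st}(RH)\to G_0^{st}(RG)$, whose images are denoted $G_0(RH)\uparrow_H^G$ and $G_0^{st}(RH)\uparrow_H^G$. Let $\mathrm H_i(\mathcal P;R)$ be the simplicial homology of $\mathcal P$ with coefficients in $R$ (chains $x_0<\dots<x_i$ being the $i$-simplices), regarded as an $RG$-module, let $G_x$ be the stabilizer of $x\in\mathcal P$, and put $$\mathrm{St}_{\mathcal P}(G)=\sum_i(-1)^i[\mathrm H_i(\mathcal P;R)]-[R]\in G_0(RG).$$ This element is called virtual projective if it lies in the subgroup of $G_0(RG)$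 generated by the classes of finitely generated projective $RG$-modules. In the sums below, $x$ runs over any set of representatives of the $G$-orbits on $\mathcal P$ (equivalently, of the isomorphism classes of objects of the transporter category $\mathcal P\rtimes G$). 1. If $\mathcal P$ is connected (in particular non-empty) and has vanishing homology, that is, $\mathrm H_i(\mathcal P;R)=0$ for all $i>0$, then $$G_0(RG)=\sum_{[x]}G_0(RG_x)\uparrow_{G_x}^G\qquad\text{and}\qquad G_0^{st}(RG)=\sum_{[x]}G_0^{st}(RG_x)\uparrow_{G_x}^G .$$ 2. If $\mathrm{St}_{\mathcal P}(G)$ is virtual projective, then $$G_0^{st}(RG)=\sum_{[x]}G_0^{st}(RG_x)\uparrow_{G_x}^G .$$ -/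

import Mathlib

open CategoryTheory

universe u v

namespace FinGPoset

noncomputable section

/-! ### Grothendieck groups of group algebras

Modules over the group algebra `R[G]` are treated as `R`-linear representations of `G`.  As `G` will
be finite, finitely generated modules are the representations which are finitely generated over `R`.
A right `R[G]`-module is regarded as a left one by letting `g` act as `g⁻¹` does on the right. -/

section Grothendieck

variable (R : Type u) [Field R] (G : Type v) [Group G]

/-- Finitely generated `R[G]`-modules (for `G` finite). -/
abbrev FinRep : Type (max u v + 1) :=
  {M : Rep.{max u v} R G // Module.Finite R M.V}

/-- The elements `[M] - [L] - [N]`, one for each short exact sequence `0 → L → M → N → 0`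
of finitely generated modules. -/
def exactRelations : Set (FreeAbelianGroup (FinRep R G)) :=
  {r | ∃ (L M N : FinRep R G) (f : L.1 ⟶ M.1) (g : M.1 ⟶ N.1) (w : f ≫ g = 0),
    (ShortComplex.mk f g w).ShortExact ∧
      r = FreeAbelianGroup.of M - FreeAbelianGroup.of L - FreeAbelianGroup.of N}

/-- The Grothendieck group `G₀(R[G])` of finitely generated `R[G]`-modules. -/
def G0 : Type (max u v + 1) :=
  FreeAbelianGroup (FinRep R G) ⧸ AddSubgroup.closure (exactRelations R G)

instance : AddCommGroup (G0 R G) :=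
  inferInstanceAs
    (AddCommGroup (FreeAbelianGroup (FinRep R G) ⧸ AddSubgroup.closure (exactRelations R G)))

variable {R G}

/-- The class `[M]` in `G₀(R[G])`. -/
def G0.cls (M : FinRep R G) : G0 R G :=
  QuotientAddGroup.mk' (AddSubgroup.closure (exactRelations R G)) (FreeAbelianGroup.of M)

variable (R G)

/-- The image of the Cartan map in `G₀(R[G])`: the subgroup generated by the classes of the
finitely generated projective modules.  Its elements are the virtual projective modules. -/
def virtualProjective : AddSubgroup (G0 R G) :=
  AddSubgroup.closure {a | ∃ P : FinRep R G, Projective P.1 ∧ a = G0.cls P}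

variable {R G}

/-- Two homomorphisms agree in the stable module category `stmod R[G]` if their difference factors
through a finitely generated projective module. -/
def StableEq {M N : FinRep R G} (f g : M.1 ⟶ N.1) : Prop :=
  ∃ (P : FinRep R G) (i : M.1 ⟶ P.1) (j : P.1 ⟶ N.1), Projective P.1 ∧ f - g = i ≫ j

/-- `M` and `N` are isomorphic objects of the stable module category. -/
def StableIso (M N : FinRep R G) : Prop :=
  ∃ (f : M.1 ⟶ N.1) (g : N.1 ⟶ M.1),
    StableEq (M := M) (N := M) (f ≫ g) (𝟙 M.1) ∧ StableEq (M := N) (N := N) (g ≫ f) (𝟙 N.1)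

variable (R G)

/-- The elements `[M] - [N]` for stably isomorphic `M` and `N`. -/
def stableRelations : Set (FreeAbelianGroup (FinRep R G)) :=
  {r | ∃ M N : FinRep R G, StableIso M N ∧ r = FreeAbelianGroup.of M - FreeAbelianGroup.of N}

/-- The stable Grothendieck group `G₀ˢᵗ(R[G])`, i.e. the Grothendieck group of the triangulated
category `stmod R[G]`.  Its generators are the objects of `stmod R[G]`; the relations identify
isomorphic objects and make the class additive on distinguished triangles, which are the triangles
isomorphic to one coming from a short exact sequence of modules. -/
def stG0 : Type (max u v + 1) :=
  FreeAbelianGroup (FinRep R G) ⧸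
    AddSubgroup.closure (exactRelations R G ∪ stableRelations R G)

instance : AddCommGroup (stG0 R G) :=
  inferInstanceAs (AddCommGroup (FreeAbelianGroup (FinRep R G) ⧸
    AddSubgroup.closure (exactRelations R G ∪ stableRelations R G)))

variable {R G}

/-- The class `[M]` in `G₀ˢᵗ(R[G])`. -/
def stG0.cls (M : FinRep R G) : stG0 R G :=
  QuotientAddGroup.mk' (AddSubgroup.closure (exactRelations R G ∪ stableRelations R G))
    (FreeAbelianGroup.of M)

end Grothendieck

/-! ### Induction -/

section Induction

variable {R : Type u} [Field R] {G : Type v} [Group G] (H : Subgroup G)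

lemma indFunctor_additive : (Rep.indFunctor.{max u v} R H.subtype).Additive where
  map_add {X Y f g} := by
    apply Rep.hom_ext
    apply Representation.IntertwiningMap.toLinearMap_injective
    apply Representation.IndV.hom_ext
    intro h
    apply LinearMap.ext
    intro x
    change Representation.Coinvariants.mk _ (TensorProduct.tmul R _ (f.hom x + g.hom x)) =
      Representation.Coinvariants.mk _ (TensorProduct.tmul R _ (f.hom x)) +
      Representation.Coinvariants.mk _ (TensorProduct.tmul R _ (g.hom x))
    rw [← map_add, TensorProduct.tmul_add]

variable [Finite G]

/-- The induced module `M ↑_H^G`. -/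
def indObj (M : FinRep R H) : FinRep R G :=
  ⟨(Rep.indFunctor R H.subtype).obj M.1, by
    have := M.2
    have : Module.Finite R (MonoidAlgebra R G) :=
      Module.Finite.equiv (MonoidAlgebra.coeffLinearEquiv R (M := G)).symm
    exact Module.Finite.of_surjective (Representation.Coinvariants.mk _)
      (Representation.Coinvariants.mk_surjective _)⟩

lemma indObj_projective (P : FinRep R H) (hP : Projective P.1) : Projective (indObj H P).1 :=
  (Rep.indResAdjunction.{max u v} R H.subtype).map_projective P.1 hP

lemma ind_exactRelations {r : FreeAbelianGroup (FinRep R H)} (hr : r ∈ exactRelations R H) :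
    FreeAbelianGroup.map (indObj H) r ∈ exactRelations R G := by
  obtain ⟨L, M, N, f, g, w, hS, rfl⟩ := hr
  have := indFunctor_additive (R := R) H
  refine ⟨indObj H L, indObj H M, indObj H N, (Rep.indFunctor R H.subtype).map f,
    (Rep.indFunctor R H.subtype).map g, 
    ((Rep.indFunctor R H.subtype).map_comp f g).symm.trans
      ((congrArg _ w).trans ((Rep.indFunctor R H.subtype).map_zero _ _)), ?_, ?_⟩
  · have : Limits.PreservesFiniteLimits (Rep.indFunctor.{max u v} R H.subtype) := by
      classical
      have := (Rep.resIndAdjunction.{max u v} R H).rightAdjoint_preservesLimits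
      infer_instance
    have : Limits.PreservesFiniteColimits (Rep.indFunctor.{max u v} R H.subtype) := by
      have := (Rep.indResAdjunction.{max u v} R H.subtype).leftAdjoint_preservesColimits
      infer_instance
    exact hS.map_of_exact (Rep.indFunctor.{max u v} R H.subtype)
  · simp [FreeAbelianGroup.map_of_apply]

lemma ind_stableEq {M N : FinRep R H} {f g : M.1 ⟶ N.1} (h : StableEq f g) :
    StableEq (M := indObj H M) (N := indObj H N)
      ((Rep.indFunctor R H.subtype).map f) ((Rep.indFunctor R H.subtype).map g) := by
  obtain ⟨P, i, j, hP, hij⟩ := h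
  have := indFunctor_additive (R := R) H
  exact ⟨indObj H P, (Rep.indFunctor R H.subtype).map i, (Rep.indFunctor R H.subtype).map j,
    indObj_projective H P hP, (Functor.map_sub _).symm.trans
      ((congrArg _ hij).trans ((Rep.indFunctor R H.subtype).map_comp i j))⟩

lemma ind_stableRelations {r : FreeAbelianGroup (FinRep R H)} (hr : r ∈ stableRelations R H) :
    FreeAbelianGroup.map (indObj H) r ∈ stableRelations R G := by
  obtain ⟨M, N, ⟨f, g, hfg, hgf⟩, rfl⟩ := hr
  refine ⟨indObj H M, indObj H N, ⟨(Rep.indFunctor R H.subtype).map f,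
    (Rep.indFunctor R H.subtype).map g, ?_, ?_⟩, ?_⟩
  · have := ind_stableEq H hfg
    rw [Functor.map_comp] at this
    have e := (Rep.indFunctor R H.subtype).map_id M.1
    exact Eq.mp (congrArg _ e) this
  · have := ind_stableEq H hgf
    rw [Functor.map_comp] at this
    have e := (Rep.indFunctor R H.subtype).map_id N.1
    exact Eq.mp (congrArg _ e) this
  · simp [FreeAbelianGroup.map_of_apply]

/-- Induction `↑_H^G : G₀(R[H]) → G₀(R[G])`, `[M] ↦ [M ↑_H^G]`. -/
def G0.ind : G0 R H →+ G0 R G :=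
  QuotientAddGroup.map _ _ (FreeAbelianGroup.map (indObj H)) <| by
    rw [AddSubgroup.closure_le]
    exact fun r hr => AddSubgroup.subset_closure (ind_exactRelations H hr)

/-- Induction `↑_H^G : G₀ˢᵗ(R[H]) → G₀ˢᵗ(R[G])`, `[M] ↦ [M ↑_H^G]`. -/
def stG0.ind : stG0 R H →+ stG0 R G :=
  QuotientAddGroup.map _ _ (FreeAbelianGroup.map (indObj H)) <| by
    rw [AddSubgroup.closure_le]
    rintro r (hr | hr)
    · exact AddSubgroup.subset_closure (Or.inl (ind_exactRelations H hr))
    · exact AddSubgroup.subset_closure (Or.inr (ind_stableRelations H hr))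

lemma G0.ind_cls (M : FinRep R H) : G0.ind H (G0.cls M) = G0.cls (indObj H M) := rfl

lemma stG0.ind_cls (M : FinRep R H) : stG0.ind H (stG0.cls M) = stG0.cls (indObj H M) := rfl

variable (R) in
/-- The subgroup `∑ₓ G₀(R[Gₓ]) ↑_{Gₓ}^G` of `G₀(R[G])`, for a family `x` of points of a `G`-set
with stabilizers `Gₓ`. -/
def G0.sumInd (G : Type v) [Group G] [Finite G] {ι P : Type v} [MulAction G P] (x : ι → P) : AddSubgroup (G0 R G) :=
  ⨆ c : ι, (G0.ind (R := R) (MulAction.stabilizer G (x c))).range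

variable (R) in
/-- The subgroup `∑ₓ G₀ˢᵗ(R[Gₓ]) ↑_{Gₓ}^G` of `G₀ˢᵗ(R[G])`, for a family `x` of points of a
`G`-set with stabilizers `Gₓ`. -/
def stG0.sumInd (G : Type v) [Group G] [Finite G] {ι P : Type v} [MulAction G P] (x : ι → P) : AddSubgroup (stG0 R G) :=
  ⨆ c : ι, (stG0.ind (R := R) (MulAction.stabilizer G (x c))).range

end Induction

/-! ### Homology of a `G`-poset -/

section Homology

/-- The strict chains `x₀ < x₁ < ⋯ < xₙ`, i.e. the normalized `n`-chains (`n`-simplices). -/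
def Chain (P : Type v) [PartialOrder P] (n : ℕ) : Type v :=
  {s : Fin (n + 1) → P // StrictMono s}

/-- The face `x₀ < ⋯ < x̂ₜ < ⋯ < xₙ₊₁` of a chain. -/
def Chain.face {P : Type v} [PartialOrder P] {n : ℕ} (t : Fin (n + 2)) (s : Chain P (n + 1)) :
    Chain P n :=
  ⟨s.1 ∘ t.succAbove, s.2.comp (Fin.strictMono_succAbove t)⟩

variable (R : Type u) [Field R] (G : Type v) [Group G]
  (P : Type v) [PartialOrder P] [MulAction G P] [CovariantClass G P (· • ·) (· ≤ ·)]

instance (n : ℕ) : MulAction G (Chain P n) where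
  smul g s := ⟨fun i => g • s.1 i, fun _ _ h =>
    lt_of_le_of_ne (CovariantClass.elim g (s.2 h).le)
      fun e => (s.2 h).ne (MulAction.injective g e)⟩
  one_smul s := Subtype.ext (funext fun i => one_smul G (s.1 i))
  mul_smul g h s := Subtype.ext (funext fun i => mul_smul g h (s.1 i))

/-- The action of `G` on the free `R`-module on the `n`-chains by permutation of the chains. -/
def chainAction (n : ℕ) : Representation R G (Chain P n →₀ R) where
  toFun g := Finsupp.lmapDomain R R (g • ·)
  map_one' := by
    ext1 s
    ext1
    simp
  map_mul' g h := by
    ext1 s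
    ext1
    simp [mul_smul]

/-- The `R[G]`-module `Cₙ(P; R)` of normalized simplicial `n`-chains. -/
def chainRep (n : ℕ) : Rep.{max u v} R G :=
  Rep.of (chainAction R G P n)

variable {P} in
/-- The linear map underlying the simplicial boundary, `s ↦ ∑ₜ (-1)ᵗ (t-th face of s)`. -/
def boundaryLin (n : ℕ) : (Chain P (n + 1) →₀ R) →ₗ[R] (Chain P n →₀ R) :=
  Finsupp.linearCombination R fun s =>
    ∑ t : Fin (n + 2), (-1 : R) ^ (t : ℕ) • Finsupp.single (s.face t) (1 : R)

variable {P} in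
lemma boundaryLin_single (n : ℕ) (s : Chain P (n + 1)) :
    boundaryLin R n (Finsupp.single s 1) =
      ∑ t : Fin (n + 2), (-1 : R) ^ (t : ℕ) • Finsupp.single (s.face t) (1 : R) := by
  simp only [boundaryLin, Finsupp.linearCombination_single, one_smul]

/-- The simplicial boundary `Cₙ₊₁(P; R) → Cₙ(P; R)`. -/
def boundary (n : ℕ) : chainRep R G P (n + 1) ⟶ chainRep R G P n :=
  Rep.ofHom ⟨boundaryLin R n, fun g => by
    ext1 s
    ext1
    change boundaryLin R n (Finsupp.mapDomain (g • ·) (Finsupp.single s 1)) =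
      Finsupp.lmapDomain R R (g • ·) (boundaryLin R n (Finsupp.single s 1))
    rw [Finsupp.mapDomain_single, boundaryLin_single, boundaryLin_single, map_sum]
    refine Finset.sum_congr rfl fun t _ => ?_
    rw [map_smul, Finsupp.lmapDomain_apply, Finsupp.mapDomain_single]
    rfl⟩

lemma boundaryLin_comp (n : ℕ) :
    (boundaryLin R n).comp (boundaryLin R (P := P) (n + 1)) = 0 := by
  ext1 s
  ext1
  have key : ∑ x : Fin (n + 3) × Fin (n + 2), (-1 : R) ^ ((x.1 : ℕ) + (x.2 : ℕ)) •
      Finsupp.single ((s.face x.1).face x.2) (1 : R) = 0 := by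
    refine Finset.sum_involution (fun x _ => (x.1.succAbove x.2, x.2.predAbove x.1)) ?_ ?_ ?_ ?_
    · rintro ⟨i, j⟩ -
      have hf : (s.face (i.succAbove j)).face (j.predAbove i) = (s.face i).face j := by
        apply Subtype.ext
        funext k
        simp [Chain.face, Fin.succAbove_succAbove_succAbove_predAbove]
      have hs := Fin.neg_one_pow_succAbove_add_predAbove (R := R) i j
      dsimp only
      rw [hf, hs, neg_smul, add_neg_cancel]
    · rintro ⟨i, j⟩ - - h
      exact Fin.succAbove_ne i j (congrArg Prod.fst h)
    · simp
    · rintro ⟨i, j⟩ -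
      simp [Fin.succAbove_succAbove_predAbove, Fin.predAbove_predAbove_succAbove]
  rw [Fintype.sum_prod_type] at key
  change boundaryLin R n (boundaryLin R (n + 1) (Finsupp.single s 1)) = 0
  rw [boundaryLin_single, map_sum, ← key]
  refine Finset.sum_congr rfl fun i _ => ?_
  rw [map_smul, boundaryLin_single, Finset.smul_sum]
  exact Finset.sum_congr rfl fun j _ => by rw [smul_smul, pow_add]

/-- The complex `C_*(P; R)` of `R[G]`-modules. -/
def chainComplex : ChainComplex (Rep.{max u v} R G) ℕ :=
  ChainComplex.of (chainRep R G P) (boundary R G P) fun n => by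
    apply Rep.hom_ext
    apply Representation.IntertwiningMap.toLinearMap_injective
    exact boundaryLin_comp R P n

/-- The homology `Hₙ(P; R)`, an `R[G]`-module. -/
def homology (n : ℕ) : Rep.{max u v} R G :=
  (chainComplex R G P).homology n

lemma homology_finite [Finite P] (n : ℕ) : Module.Finite R (homology R G P n).V := by
  have : Finite (Chain P n) := Subtype.finite
  have h1 : Module.Finite R ((chainComplex R G P).X n).V :=
    inferInstanceAs (Module.Finite R (Chain P n →₀ R))
  have h2 : Module.Finite R ((chainComplex R G P).cycles n).V :=
    Module.Finite.of_injective ((chainComplex R G P).iCycles n).hom.toLinearMap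
      ((Rep.mono_iff_injective _).1 inferInstance)
  exact Module.Finite.of_surjective ((chainComplex R G P).homologyπ n).hom.toLinearMap
      ((Rep.epi_iff_surjective _).1 inferInstance)

/-- The trivial `R[G]`-module `R`. -/
def trivialRep : FinRep R G :=
  ⟨Rep.trivial R G (ULift.{v} R), inferInstance⟩

/-- The generalized Steinberg representation
`St_P(G) = ∑ₙ (-1)ⁿ [Hₙ(P; R)] - [R]` in `G₀(R[G])`.  A strict chain `x₀ < ⋯ < xₙ` in `P` exists
only for `n < |P|`, so that the homology vanishes in all degrees that are left out. -/
def steinberg [Finite P] : G0 R G :=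
  ∑ n ∈ Finset.range (Nat.card P),
      (-1 : ℤ) ^ n • G0.cls ⟨homology R G P n, homology_finite R G P n⟩
    - G0.cls (trivialRep R G)

end Homology

end

end FinGPoset

/-!
Every `M` is `R ⊗ M`, so it suffices to write `[R]` in terms of the chain modules `Cₙ(P; R)`.  By
the Euler–Poincaré formula (`sum_cls_chainRep`), `∑ₙ (-1)ⁿ [Cₙ(P; R)] = St_P(G) + [R]`.  Since
`- ⊗ M` is exact, it acts on `G₀(R[G])`, whence
`∑ₙ (-1)ⁿ [Cₙ(P; R) ⊗ M] = St_P(G) ⊗ M + [M]` (`tensorHom_steinberg_add_cls_mem`).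

The left hand side lies in the sum of the images of induction.  Indeed `Cₙ(P; R) ⊗ M` is graded by
the `G`-set `P`, a chain having its least element as its degree, and `G` permutes the homogeneous
parts; a module `W` with such a grading is the direct sum, over orbit representatives `x`, of the
modules induced from the action of the stabilizer of `x` on `W_x` (`G0.cls_mem_sumInd`).

If `P` is connected with vanishing higher homology, then `H₀(P; R) ≅ R` and `St_P(G) = 0`, so `[M]`
itself is a sum of induced classes.  If `St_P(G)` is only virtual projective, so is `St_P(G) ⊗ M`,
because `- ⊗ M` preserves projectives (`projective_tensor`), and it vanishes in the stable
Grothendieck group.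
-/

namespace FinGPoset

noncomputable section

/-! ### Short exact sequences of representations and the class `[M]` -/

lemma rep_exact_iff {R : Type u} [Field R] {G : Type v} [Group G]
    (S : ShortComplex (Rep.{max u v} R G)) :
    S.Exact ↔ Function.Exact S.f.hom S.g.hom := by
  rw [← ShortComplex.exact_map_iff_of_faithful S
      (forget₂ (Rep.{max u v} R G) (ModuleCat.{max u v} R)),
    ShortComplex.ShortExact.moduleCat_exact_iff_function_exact]
  rfl

lemma rep_shortExact_iff {R : Type u} [Field R] {G : Type v} [Group G]
    (S : ShortComplex (Rep.{max u v} R G)) :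
    S.ShortExact ↔ Function.Injective S.f.hom ∧ Function.Exact S.f.hom S.g.hom ∧
      Function.Surjective S.g.hom := by
  rw [← rep_exact_iff, ← Rep.mono_iff_injective, ← Rep.epi_iff_surjective]
  exact ⟨fun h => ⟨h.mono_f, h.exact, h.epi_g⟩, fun h =>
    { exact := h.2.1, mono_f := h.1, epi_g := h.2.2 }⟩

section Classes

variable {R : Type u} [Field R] {G : Type v} [Group G]

lemma G0.cls_shortExact {S : ShortComplex (Rep.{max u v} R G)} (hS : S.ShortExact)
    (h₁ : Module.Finite R S.X₁.V) (h₂ : Module.Finite R S.X₂.V) (h₃ : Module.Finite R S.X₃.V) :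
    G0.cls ⟨S.X₂, h₂⟩ = G0.cls ⟨S.X₁, h₁⟩ + G0.cls ⟨S.X₃, h₃⟩ := by
  have : QuotientAddGroup.mk' (AddSubgroup.closure (exactRelations R G))
      (FreeAbelianGroup.of ⟨S.X₂, h₂⟩ - FreeAbelianGroup.of ⟨S.X₁, h₁⟩ -
        FreeAbelianGroup.of ⟨S.X₃, h₃⟩) = 0 :=
    (QuotientAddGroup.eq_zero_iff _).2
      (AddSubgroup.subset_closure ⟨⟨_, h₁⟩, ⟨_, h₂⟩, ⟨_, h₃⟩, S.f, S.g, S.zero, hS, rfl⟩)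
  rw [map_sub, map_sub, sub_sub] at this
  exact sub_eq_zero.1 this

lemma G0.cls_of_isZero {M : FinRep R G} (hM : Limits.IsZero M.1) : G0.cls M = 0 := by
  have h := G0.cls_shortExact (S := ShortComplex.mk (0 : M.1 ⟶ M.1) (0 : M.1 ⟶ M.1) (by simp))
    { exact := ShortComplex.exact_of_isZero_X₂ _ hM
      mono_f := ⟨fun _ _ _ => hM.eq_of_tgt _ _⟩
      epi_g := ⟨fun _ _ _ => hM.eq_of_src _ _⟩ } M.2 M.2 M.2
  simpa using h

lemma G0.cls_congr {M N : FinRep R G} (e : M.1 ≅ N.1) : G0.cls M = G0.cls N := by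
  have hZ : Limits.IsZero (Rep.trivial R G PUnit.{max u v + 1}) :=
    (Rep.isZero_iff _ _ _).2 inferInstance
  have h := G0.cls_shortExact
    (S := ShortComplex.mk e.hom (0 : N.1 ⟶ Rep.trivial R G PUnit.{max u v + 1}) (by simp))
    { exact := (ShortComplex.exact_iff_epi _ rfl).2 (inferInstance : Epi e.hom)
      mono_f := (inferInstance : Mono e.hom)
      epi_g := ⟨fun _ _ _ => hZ.eq_of_src _ _⟩ } M.2 N.2 inferInstance
  rw [G0.cls_of_isZero (M := ⟨_, _⟩) hZ, add_zero] at h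
  exact h.symm

lemma finite_of_mono {M N : Rep.{max u v} R G} (f : M ⟶ N) [Mono f] [Module.Finite R N.V] :
    Module.Finite R M.V :=
  Module.Finite.of_injective f.hom.toLinearMap ((Rep.mono_iff_injective _).1 inferInstance)

lemma finite_of_epi {M N : Rep.{max u v} R G} (f : M ⟶ N) [Epi f] [Module.Finite R M.V] :
    Module.Finite R N.V :=
  Module.Finite.of_surjective f.hom.toLinearMap ((Rep.epi_iff_surjective _).1 inferInstance)

lemma shortExact_kernel {M N : Rep.{max u v} R G} (f : M ⟶ N) [Epi f] :
    (ShortComplex.mk (Limits.kernel.ι f) f (Limits.kernel.condition f)).ShortExact where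
  exact := ShortComplex.exact_kernel f
  mono_f := inferInstance
  epi_g := inferInstance

/-- A finite family of split quotients `A c` of `W`, mutually orthogonal and jointly faithful,
exhibits `W` as a direct sum, so that `[W] = ∑ [A c]`. -/
lemma G0.cls_eq_sum {ι : Type*} (A : ι → FinRep R G) (S : Finset ι) (W : FinRep R G)
    (i : ∀ c, (A c).1 ⟶ W.1) (p : ∀ c, W.1 ⟶ (A c).1) (hip : ∀ c ∈ S, i c ≫ p c = 𝟙 _)
    (hne : ∀ c ∈ S, ∀ d ∈ S, c ≠ d → i c ≫ p d = 0)
    (hinj : ∀ w : W.1.V, (∀ c ∈ S, (p c).hom w = 0) → w = 0) :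
    G0.cls W = ∑ c ∈ S, G0.cls (A c) := by
  classical
  induction S using Finset.induction_on generalizing W with
  | empty =>
    rw [Finset.sum_empty]
    exact G0.cls_of_isZero ((Rep.isZero_iff _ _ _).2
      ⟨fun x y => (hinj x (by simp)).trans (hinj y (by simp)).symm⟩)
  | insert a T ha ih =>
    have := W.2
    have : Epi (p a) := ⟨fun f g h => by
      simpa [← Category.assoc, hip a (Finset.mem_insert_self a T)] using congrArg (i a ≫ ·) h⟩
    have hK : Module.Finite R (Limits.kernel (p a)).V := finite_of_mono (Limits.kernel.ι (p a))
    rw [Finset.sum_insert ha, G0.cls_shortExact (shortExact_kernel (p a)) hK W.2 (A a).2, add_comm]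
    congr 1
    have hia : ∀ c ∈ T, i c ≫ p a = 0 := fun c hc =>
      hne c (Finset.mem_insert_of_mem hc) a (Finset.mem_insert_self a T)
        fun h => ha (h ▸ hc)
    -- Only the indices in `T` matter for the kernel of `p a`; zero is a junk value at the others.
    refine ih ⟨_, hK⟩
      (fun c => if h : i c ≫ p a = 0 then Limits.kernel.lift (p a) (i c) h else 0)
      (fun c => Limits.kernel.ι (p a) ≫ p c) ?_ ?_ ?_
    · intro c hc
      rw [dif_pos (hia c hc), Limits.kernel.lift_ι_assoc, hip c (Finset.mem_insert_of_mem hc)]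
    · intro c hc d hd hcd
      rw [dif_pos (hia c hc), Limits.kernel.lift_ι_assoc,
        hne c (Finset.mem_insert_of_mem hc) d (Finset.mem_insert_of_mem hd) hcd]
    · intro w hw
      apply (Rep.mono_iff_injective (Limits.kernel.ι (p a))).1 inferInstance
      rw [map_zero]
      refine hinj _ fun c hc => ?_
      rcases Finset.mem_insert.1 hc with rfl | hc
      · exact congr($(congrArg Rep.Hom.hom (Limits.kernel.condition (p c))) w)
      · exact hw c hc

end Classes

/-! ### Euler characteristics -/

section Euler

variable {R : Type u} [Field R] {G : Type v} [Group G]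
  (K : ChainComplex (Rep.{max u v} R G) ℕ) (hK : ∀ n, Module.Finite R (K.X n).V)

include hK in
lemma finite_cycles (n : ℕ) : Module.Finite R (K.cycles n).V :=
  have := hK n
  finite_of_mono (K.iCycles n)

include hK in
lemma finite_homology (n : ℕ) : Module.Finite R (K.homology n).V :=
  have := finite_cycles K hK n
  finite_of_epi (K.homologyπ n)

/-- The kernel of `Zₙ → Hₙ` serves as the module of boundaries: it is the image of `Kₙ₊₁`, whose
kernel in `Kₙ₊₁` is `Zₙ₊₁`. -/
lemma shortExact_boundaries (n : ℕ) :
    (ShortComplex.mk (K.iCycles (n + 1))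
      (Limits.kernel.lift (K.homologyπ n) (K.toCycles (n + 1) n)
        (K.toCycles_comp_homologyπ (n + 1) n))
      (by simp [← cancel_mono (Limits.kernel.ι (K.homologyπ n)),
        ← cancel_mono (K.iCycles n)])).ShortExact where
  exact := by
    refine ShortComplex.exact_of_f_is_kernel _ (Limits.KernelFork.IsLimit.ofι' _ _ fun k hk => ?_)
    have hk' : k ≫ K.d (n + 1) n = 0 := by
      have := congrArg (· ≫ Limits.kernel.ι (K.homologyπ n) ≫ K.iCycles n) hk
      simpa using this
    exact ⟨K.liftCycles k n (by simp) hk', by simp⟩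
  mono_f := inferInstance
  epi_g := by
    have : (ShortComplex.mk (K.toCycles (n + 1) n) (K.homologyπ n)
        (K.toCycles_comp_homologyπ (n + 1) n)).Exact :=
      ShortComplex.exact_of_g_is_cokernel _ (K.homologyIsCokernel (n + 1) n (by simp))
    exact this.epi_kernelLift

/-- The Euler characteristic of a complex truncated at degree `N`. -/
lemma sum_cls_complex (N : ℕ) :
    ∑ n ∈ Finset.range (N + 1), (-1 : ℤ) ^ n • G0.cls ⟨K.X n, hK n⟩ =
      ∑ n ∈ Finset.range N, (-1 : ℤ) ^ n • G0.cls ⟨K.homology n, finite_homology K hK n⟩ +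
        (-1 : ℤ) ^ N • G0.cls ⟨K.cycles N, finite_cycles K hK N⟩ := by
  induction N with
  | zero =>
    have : IsIso (K.iCycles 0) := K.isIso_iCycles 0 _ rfl (by simp)
    simpa using (G0.cls_congr (M := ⟨K.cycles 0, finite_cycles K hK 0⟩) (N := ⟨K.X 0, hK 0⟩)
      (asIso (K.iCycles 0))).symm
  | succ N ih =>
    have := finite_cycles K hK N
    have hB : Module.Finite R (Limits.kernel (K.homologyπ N)).V :=
      finite_of_mono (Limits.kernel.ι (K.homologyπ N))
    have h1 := G0.cls_shortExact (shortExact_kernel (K.homologyπ N)) hB (finite_cycles K hK N)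
      (finite_homology K hK N)
    have h2 := G0.cls_shortExact (shortExact_boundaries K N) (finite_cycles K hK (N + 1))
      (hK (N + 1)) hB
    dsimp only at h1 h2
    rw [Finset.sum_range_succ, ih, Finset.sum_range_succ _ N, h1, h2, pow_succ]
    module

end Euler

/-! ### Tensor products -/

section Tensor

open TensorProduct

variable {R : Type u} [Field R] {G : Type v} [Group G]

/-- The tensor product over `R` of two representations, with the diagonal action. (The monoidal
structure of `Rep` is not available here, because it forces `R` and the modules into one
universe.) -/
def tensor (X M : Rep.{max u v} R G) : Rep.{max u v} R G :=
  Rep.of (X.ρ.tprod M.ρ)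

/-- The map `f ⊗ M`. -/
def tensorMap {X Y : Rep.{max u v} R G} (f : X ⟶ Y) (M : Rep.{max u v} R G) :
    tensor X M ⟶ tensor Y M :=
  Rep.ofHom (ρ := X.ρ.tprod M.ρ) (σ := Y.ρ.tprod M.ρ) ⟨f.hom.toLinearMap.rTensor M.V, fun g => by
    ext x m
    simp [Rep.hom_comm_apply]⟩

lemma tensorMap_shortExact {X Y Z : Rep.{max u v} R G} (f : X ⟶ Y) (g : Y ⟶ Z) (w : f ≫ g = 0)
    (h : (ShortComplex.mk f g w).ShortExact) (M : Rep.{max u v} R G) :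
    ∃ w' : tensorMap f M ≫ tensorMap g M = 0,
      (ShortComplex.mk (tensorMap f M) (tensorMap g M) w').ShortExact := by
  obtain ⟨h1, h2, h3⟩ := (rep_shortExact_iff _).1 h
  have hex : Function.Exact (f.hom.toLinearMap.rTensor M.V) (g.hom.toLinearMap.rTensor M.V) :=
    rTensor_exact M.V h2 h3
  refine ⟨?_, (rep_shortExact_iff _).2 ⟨?_, hex, ?_⟩⟩
  · apply Rep.hom_ext
    apply Representation.IntertwiningMap.toLinearMap_injective
    exact hex.linearMap_comp_eq_zero
  · exact Module.Flat.rTensor_preserves_injective_linearMap f.hom.toLinearMap h1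
  · exact LinearMap.rTensor_surjective M.V h3

/-- The finitely generated module `X ⊗ M`. -/
def tensorObj (M X : FinRep R G) : FinRep R G :=
  ⟨tensor X.1 M.1, by
    have := M.2
    have := X.2
    exact inferInstanceAs (Module.Finite R (X.1.V ⊗[R] M.1.V))⟩

/-- The endomorphism `[X] ↦ [X ⊗ M]` of `G₀(R[G])`. -/
def G0.tensorHom (M : FinRep R G) : G0 R G →+ G0 R G :=
  QuotientAddGroup.map _ _ (FreeAbelianGroup.map (tensorObj M)) <| by
    rw [AddSubgroup.closure_le]
    rintro r ⟨X, Y, Z, f, g, w, hS, rfl⟩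
    obtain ⟨w', hS'⟩ := tensorMap_shortExact f g w hS M.1
    exact AddSubgroup.subset_closure ⟨tensorObj M X, tensorObj M Y, tensorObj M Z, _, _, w', hS',
      by simp [FreeAbelianGroup.map_of_apply]⟩

/-- `R ⊗ M ≅ M`. -/
def tensorTrivialIso (M : FinRep R G) : (tensorObj M (trivialRep R G)).1 ≅ M.1 :=
  Rep.mkIso (ρ := ((trivialRep R G).1.ρ.tprod M.1.ρ)) (σ := M.1.ρ)
    (.mk (TensorProduct.congr ULift.moduleEquiv (.refl R M.1.V) ≪≫ₗ TensorProduct.lid R M.1.V)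
      fun g => by
        refine TensorProduct.ext' fun x m => ?_
        change x.down • M.1.ρ g m = M.1.ρ g (x.down • m)
        rw [map_smul])

/-- Tensoring with `M` preserves projectivity: a map `X ⊗ M ⟶ B` is the same as a map
`X ⟶ Hom(M, B)`, and `Hom(M, -)` preserves surjections over a field. -/
lemma projective_tensor {X : Rep.{max u v} R G} (hX : Projective X) (M : Rep.{max u v} R G) :
    Projective (tensor X M) where
  factors {A B} f e he := by
    have hsurj : Function.Surjective e.hom.toLinearMap := (Rep.epi_iff_surjective e).1 he
    obtain ⟨s, hs⟩ := e.hom.toLinearMap.exists_rightInverse_of_surjective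
      (LinearMap.range_eq_top.2 hsurj)
    have : Epi ((Rep.ihom M).map e) := (Rep.epi_iff_surjective _).2 fun (φ : M.V →ₗ[R] B.V) =>
      ⟨s ∘ₗ φ, LinearMap.ext fun m => congr($hs (φ m))⟩
    let f' : X ⟶ (Rep.ihom M).obj B :=
      Rep.ofHom (σ := M.ρ.linHom B.ρ)
        ⟨TensorProduct.curry (M := X.V) (N := M.V) f.hom.toLinearMap, fun g => by
        ext x m
        have := Rep.hom_comm_apply f g (x ⊗ₜ M.ρ g⁻¹ m)
        change f.hom (X.ρ g x ⊗ₜ M.ρ g (M.ρ g⁻¹ m)) = _ at this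
        rw [Representation.self_inv_apply] at this
        exact this⟩
    obtain ⟨l, hl⟩ := hX.factors f' ((Rep.ihom M).map e)
    let l' : X.V →ₗ[R] M.V →ₗ[R] A.V := l.hom.toLinearMap
    refine ⟨Rep.ofHom (ρ := X.ρ.tprod M.ρ) ⟨TensorProduct.lift l', fun g => by
      refine TensorProduct.ext' fun x m => ?_
      have := LinearMap.congr_fun (f := l.hom (X.ρ g x)) (Rep.hom_comm_apply l g x) (M.ρ g m)
      change l' (X.ρ g x) (M.ρ g m) = A.ρ g (l' x (M.ρ g⁻¹ (M.ρ g m))) at this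
      rw [Representation.inv_self_apply] at this
      exact this⟩, ?_⟩
    apply Rep.hom_ext
    apply Representation.IntertwiningMap.toLinearMap_injective
    refine TensorProduct.ext' fun x m => ?_
    exact LinearMap.congr_fun (f := (l ≫ (Rep.ihom M).map e).hom x)
      congr($(congrArg Rep.Hom.hom hl) x) m

lemma G0.tensorHom_mem_virtualProjective (M : FinRep R G) {a : G0 R G}
    (ha : a ∈ virtualProjective R G) : G0.tensorHom M a ∈ virtualProjective R G := by
  have : virtualProjective R G ≤ (virtualProjective R G).comap (G0.tensorHom M) := by
    refine (AddSubgroup.closure_le _).2 ?_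
    rintro _ ⟨X, hX, rfl⟩
    exact AddSubgroup.subset_closure ⟨tensorObj M X, projective_tensor hX M.1, rfl⟩
  exact this ha

end Tensor

/-! ### Modules graded by a `G`-set -/

section IndToCoind

variable {k : Type u} [CommRing k] {G : Type v} [Group G] {S : Subgroup G}
  [DecidableRel (QuotientGroup.rightRel S)] (A : Rep.{max u v} k S)

lemma indToCoind_mk (h : G) (a : A.V) :
    (Rep.indToCoind A (Representation.IndV.mk _ _ h a)).1 = Rep.indToCoindAux A h a := by
  simp
  rfl

lemma indToCoindAux_one_of_mem (s : S) (a : A.V) :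
    Rep.indToCoindAux A 1 a s = A.ρ s a := by
  simpa using Rep.indToCoindAux_mul_snd 1 1 a s

end IndToCoind

section Graded

variable {R : Type u} [Field R] {G : Type v} [Group G] [Finite G] {P : Type v} [MulAction G P]

/-- The degree `x` part of `W`, as a representation of the stabilizer of `x`. The grading of `W` by
`P` is encoded by the family `p` of projections onto its homogeneous parts. -/
def degreePart (W : FinRep R G) (p : P → W.1.V →ₗ[R] W.1.V)
    (hequiv : ∀ g x w, W.1.ρ g (p x w) = p (g • x) (W.1.ρ g w)) (x : P) :
    FinRep R (MulAction.stabilizer G x) :=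
  ⟨Rep.subrepresentation (Rep.res (MulAction.stabilizer G x).subtype W.1) (LinearMap.range (p x))
    fun g => by
      rintro _ ⟨w, rfl⟩
      refine ⟨W.1.ρ g w, ?_⟩
      have h := hequiv g x w
      rw [show (g : G) • x = x from g.2] at h
      exact h.symm,
    have := W.2
    (inferInstance : Module.Finite R (LinearMap.range (p x)))⟩

variable (W : FinRep R G) (p : P → W.1.V →ₗ[R] W.1.V)
    (hequiv : ∀ g x w, W.1.ρ g (p x w) = p (g • x) (W.1.ρ g w))

/-- The map `Ind W_x ⟶ W` extending the inclusion of the degree `x` part. -/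
def degreeIncl (x : P) : (indObj _ (degreePart W p hequiv x)).1 ⟶ W.1 :=
  (Rep.indResHomEquiv (MulAction.stabilizer G x).subtype (degreePart W p hequiv x).1 W.1).symm
    (Rep.ofHom ⟨(LinearMap.range (p x)).subtype, fun _ => rfl⟩)

/-- The projection of `W` onto its degree `x` part. -/
def degreeProjRes (x : P) :
    Rep.res (MulAction.stabilizer G x).subtype W.1 ⟶ (degreePart W p hequiv x).1 :=
  Rep.ofHom ⟨(p x).rangeRestrict, fun g => by
    ext w
    have h := hequiv g x w
    rw [show (g : G) • x = x from g.2] at h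
    exact h.symm⟩

/-- The map `w ↦ (g ↦ p x (g w))` to the coinduced module, whose elements are functions on `G`. -/
def degreeProjCoind (x : P) :
    W.1 ⟶ Rep.coind (MulAction.stabilizer G x).subtype (degreePart W p hequiv x).1 :=
  Rep.resCoindHomEquiv.{max u v} (MulAction.stabilizer G x).subtype W.1 _
    (degreeProjRes W p hequiv x)

omit [Finite G] in
lemma degreeProjCoind_apply (x : P) (w : W.1.V) (g : G) :
    (((degreeProjCoind W p hequiv x).hom w).1 g : LinearMap.range (p x)).1 =
      p x (W.1.ρ g w) := rfl

open scoped Classical in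
/-- The projection `W ⟶ Ind W_x`, obtained from the map to the coinduced module by identifying
induction with coinduction. -/
def degreeProj (x : P) : W.1 ⟶ (indObj _ (degreePart W p hequiv x)).1 :=
  degreeProjCoind W p hequiv x ≫ (Rep.indCoindIso.{max u v} (degreePart W p hequiv x).1).inv

open scoped Classical in
lemma degreeProj_eq_zero_iff (x : P) (w : W.1.V) :
    (degreeProj W p hequiv x).hom w = 0 ↔ ∀ g, p x (W.1.ρ g w) = 0 := by
  have hinj := (Rep.mono_iff_injective
    (Rep.indCoindIso.{max u v} (degreePart W p hequiv x).1).inv).1 inferInstance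
  change (Rep.indCoindIso.{max u v} (degreePart W p hequiv x).1).inv.hom
    ((degreeProjCoind W p hequiv x).hom w) = 0 ↔ _
  rw [map_eq_zero_iff _ hinj]
  constructor
  · intro h g
    rw [← degreeProjCoind_apply W p hequiv, h]
    rfl
  · exact fun h => Subtype.ext (funext fun g => Subtype.ext (h g))

lemma degreeIncl_mk_one (x : P) (a : (degreePart W p hequiv x).1.V) :
    (degreeIncl W p hequiv x).hom (Representation.IndV.mk _ _ 1 a) =
      (show LinearMap.range (p x) from a).1 := by
  have h := (Rep.indResHomEquiv (MulAction.stabilizer G x).subtype (degreePart W p hequiv x).1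
    W.1).apply_symm_apply (Rep.ofHom ⟨(LinearMap.range (p x)).subtype, fun _ => rfl⟩)
  exact congr($(congrArg Rep.Hom.hom h) a)

variable (hidem : ∀ x w, p x (p x w) = p x w) (horth : ∀ x y w, x ≠ y → p x (p y w) = 0)

include hidem horth in
/-- After identifying induction with coinduction, the composite and the identity both restrict to
`W_x ⟶ Coind W_x`, `a ↦ (g ↦ p x (g a))`: as `g a` has degree `g • x`, this function vanishes off
the stabilizer of `x`. -/
lemma degreeIncl_comp_degreeProj (x : P) :
    degreeIncl W p hequiv x ≫ degreeProj W p hequiv x = 𝟙 _ := by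
  classical
  refine (Category.assoc _ _ _).symm.trans ((Iso.comp_inv_eq _).2
    (.trans ?_ (Category.id_comp _).symm))
  apply (Rep.indResHomEquiv (MulAction.stabilizer G x).subtype _ _).injective
  apply Rep.hom_ext
  apply Representation.IntertwiningMap.toLinearMap_injective
  ext a : 1
  obtain ⟨a, w, rfl⟩ := a
  refine Subtype.ext (funext fun g => Subtype.ext ?_)
  change p x (W.1.ρ g ((degreeIncl W p hequiv x).hom
    (Representation.IndV.mk _ _ 1 ⟨p x w, w, rfl⟩))) = _
  refine (congrArg (fun v => p x (W.1.ρ g v))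
    (degreeIncl_mk_one W p hequiv x ⟨p x w, w, rfl⟩)).trans ?_
  change p x (W.1.ρ g (p x w)) = ((Rep.indToCoind.{max u v} (degreePart W p hequiv x).1
    (Representation.IndV.mk _ _ 1 ⟨p x w, w, rfl⟩)).1 g : LinearMap.range (p x)).1
  rw [show (Rep.indToCoind.{max u v} (degreePart W p hequiv x).1
    (Representation.IndV.mk _ _ 1 ⟨p x w, w, rfl⟩)).1 = _ from indToCoind_mk _ _ _]
  by_cases hg : g • x = x
  · refine Eq.trans ?_ (congrArg Subtype.val (indToCoindAux_one_of_mem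
      (S := MulAction.stabilizer G x) (A := (degreePart W p hequiv x).1)
      ⟨g, hg⟩ ⟨p x w, w, rfl⟩).symm)
    change _ = W.1.ρ g (p x w)
    rw [hequiv, hg, hidem]
  · rw [hequiv, horth _ _ _ (Ne.symm hg)]
    refine (congrArg Subtype.val (Rep.indToCoindAux_of_not_rel (S := MulAction.stabilizer G x)
      (A := (degreePart W p hequiv x).1) 1 g ⟨p x w, w, rfl⟩ ?_)).symm
    rintro ⟨s, hs⟩
    refine hg ?_
    have : g = s := by simpa [Subgroup.smul_def] using hs.symm
    rw [this]
    exact s.2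

include horth in
lemma degreeIncl_comp_degreeProj_of_ne (x y : P) (hxy : ∀ g : G, g • x ≠ y) :
    degreeIncl W p hequiv x ≫ degreeProj W p hequiv y = 0 := by
  apply (Rep.indResHomEquiv (MulAction.stabilizer G x).subtype _ _).injective
  apply Rep.hom_ext
  apply Representation.IntertwiningMap.toLinearMap_injective
  ext a : 1
  obtain ⟨a, w, rfl⟩ := a
  change (degreeProj W p hequiv y).hom
    ((degreeIncl W p hequiv x).hom (Representation.IndV.mk _ _ 1 ⟨p x w, w, rfl⟩)) = 0
  refine (congrArg _ (degreeIncl_mk_one W p hequiv x ⟨p x w, w, rfl⟩)).trans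
    ((degreeProj_eq_zero_iff W p hequiv y _).2 fun g => ?_)
  change p y (W.1.ρ g (p x w)) = 0
  rw [hequiv, horth _ _ _ (hxy g).symm]

/-- A module which is graded by a finite `G`-set, compatibly with the action of `G`, is the sum of
the modules induced from the stabilizers of orbit representatives. -/
theorem G0.cls_mem_sumInd [Finite P] (rep : MulAction.orbitRel.Quotient G P → P)
    (hrep : ∀ c, (Quotient.mk'' (rep c) : MulAction.orbitRel.Quotient G P) = c)
    (W : FinRep R G) (p : P → W.1.V →ₗ[R] W.1.V)
    (hequiv : ∀ g x w, W.1.ρ g (p x w) = p (g • x) (W.1.ρ g w))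
    (hidem : ∀ x w, p x (p x w) = p x w) (horth : ∀ x y w, x ≠ y → p x (p y w) = 0)
    (hinj : ∀ w, (∀ x, p x w = 0) → w = 0) :
    G0.cls W ∈ G0.sumInd R G rep := by
  have := Fintype.ofFinite (MulAction.orbitRel.Quotient G P)
  rw [G0.cls_eq_sum (fun c => indObj _ (degreePart W p hequiv (rep c))) Finset.univ W
    (fun c => degreeIncl W p hequiv (rep c)) (fun c => degreeProj W p hequiv (rep c))
    (fun c _ => degreeIncl_comp_degreeProj W p hequiv hidem horth (rep c)) ?_ ?_]
  · exact AddSubgroup.sum_mem _ fun c _ => AddSubgroup.mem_iSup_of_mem c ⟨G0.cls _, rfl⟩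
  · refine fun c _ d _ hcd => degreeIncl_comp_degreeProj_of_ne W p hequiv horth _ _ fun g hg => ?_
    rw [← hrep c, ← hrep d, ← hg] at hcd
    exact hcd (Quotient.sound ⟨g⁻¹, inv_smul_smul g (rep c)⟩)
  · refine fun w hw => hinj w fun x => ?_
    obtain ⟨g, hg⟩ : ∃ g : G, g • x = rep (Quotient.mk'' x) :=
      Quotient.exact (hrep (Quotient.mk'' x))
    have h := (degreeProj_eq_zero_iff W p hequiv _ w).1 (hw (Quotient.mk'' x) (Finset.mem_univ _)) g
    rw [← hg, ← hequiv] at h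
    exact (map_eq_zero_iff _ (W.1.ρ.apply_bijective g).1).1 h

end Graded

/-! ### Chains of a finite `G`-poset -/

section Chains

open TensorProduct

variable (R : Type u) [Field R] {G : Type v} [Group G]
  {P : Type v} [PartialOrder P] [MulAction G P] [CovariantClass G P (· • ·) (· ≤ ·)]

lemma chain_lt_card [Finite P] {n : ℕ} (s : Chain P n) : n < Nat.card P := by
  simpa using Nat.card_le_card_of_injective s.1 s.2.injective

lemma finite_chains [Finite P] (n : ℕ) : Module.Finite R (Chain P n →₀ R) := by
  have : Finite (Chain P n) := Subtype.finite
  infer_instance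

open scoped Classical in
/-- The projection of `Cₙ(P; R)` onto the span of the chains with least element `x`. -/
def chainProj (n : ℕ) (x : P) : (Chain P n →₀ R) →ₗ[R] (Chain P n →₀ R) :=
  Finsupp.linearCombination R fun s => if s.1 0 = x then Finsupp.single s 1 else 0

open scoped Classical in
lemma chainProj_single (n : ℕ) (x : P) (s : Chain P n) :
    chainProj R n x (Finsupp.single s 1) = if s.1 0 = x then Finsupp.single s 1 else 0 := by
  simp only [chainProj, Finsupp.linearCombination_single, one_smul]

lemma chainProj_comp_self (n : ℕ) (x : P) :
    chainProj R n x ∘ₗ chainProj R n x = chainProj R n x := by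
  ext1 s
  ext1
  change chainProj R n x (chainProj R n x (Finsupp.single s 1)) =
    chainProj R n x (Finsupp.single s 1)
  rw [chainProj_single]
  split_ifs with h
  · rw [chainProj_single, if_pos h]
  · rw [map_zero]

lemma chainProj_comp_of_ne (n : ℕ) {x y : P} (hxy : x ≠ y) :
    chainProj R n x ∘ₗ chainProj R n y = 0 := by
  ext1 s
  ext1
  change chainProj R n x (chainProj R n y (Finsupp.single s 1)) = 0
  rw [chainProj_single]
  split_ifs with h
  · rw [chainProj_single, if_neg (h.trans_ne hxy.symm)]
  · rw [map_zero]

lemma sum_chainProj [Fintype P] (n : ℕ) :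
    ∑ x : P, chainProj R n x = LinearMap.id := by
  classical
  ext1 s
  ext1
  change (∑ x : P, chainProj R n x) (Finsupp.single s 1) = Finsupp.single s 1
  simp [LinearMap.sum_apply, chainProj_single]

lemma chainAction_comp_chainProj (n : ℕ) (g : G) (x : P) :
    chainAction R G P n g ∘ₗ chainProj R n x =
      chainProj R n (g • x) ∘ₗ chainAction R G P n g := by
  classical
  ext1 s
  ext1
  change Finsupp.lmapDomain R R (g • ·) (chainProj R n x (Finsupp.single s 1)) =
    chainProj R n (g • x) (Finsupp.lmapDomain R R (g • ·) (Finsupp.single s 1))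
  rw [chainProj_single, Finsupp.lmapDomain_apply, Finsupp.lmapDomain_apply,
    Finsupp.mapDomain_single, chainProj_single]
  have : (g • s).1 0 = g • x ↔ s.1 0 = x := smul_left_cancel_iff (α := G) (β := P) g
  split_ifs with h h' h'
  · exact Finsupp.mapDomain_single
  · exact absurd (this.2 h) h'
  · exact absurd (this.1 h') h
  · exact Finsupp.mapDomain_zero

/-- `Cₙ(P; R) ⊗ M` is graded by `P`, a chain having its least element as its degree. -/
lemma cls_tensor_chainRep_mem [Finite G] [Finite P] (rep : MulAction.orbitRel.Quotient G P → P)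
    (hrep : ∀ c, (Quotient.mk'' (rep c) : MulAction.orbitRel.Quotient G P) = c)
    (M : FinRep R G) (n : ℕ) :
    G0.cls (tensorObj M ⟨chainRep R G P n, finite_chains R n⟩) ∈ G0.sumInd R G rep := by
  have := Fintype.ofFinite P
  refine G0.cls_mem_sumInd rep hrep _ (fun x => (chainProj R n x).rTensor M.1.V) ?_ ?_ ?_ ?_
  · intro g x w
    have : TensorProduct.map (chainAction R G P n g) (M.1.ρ g) ∘ₗ (chainProj R n x).rTensor M.1.V =
        (chainProj R n (g • x)).rTensor M.1.V ∘ₗ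
          TensorProduct.map (chainAction R G P n g) (M.1.ρ g) := by
      rw [LinearMap.map_comp_rTensor, LinearMap.rTensor_comp_map, chainAction_comp_chainProj]
    exact congr($this w)
  · intro x w
    have := LinearMap.rTensor_comp M.1.V (chainProj R n x) (chainProj R n x)
    rw [chainProj_comp_self] at this
    exact congr($this.symm w)
  · intro x y w hxy
    have := LinearMap.rTensor_comp M.1.V (chainProj R n x) (chainProj R n y)
    rw [chainProj_comp_of_ne R n hxy, LinearMap.rTensor_zero] at this
    exact congr($this.symm w)
  · intro w hw
    have : ∑ x : P, (chainProj R n x).rTensor M.1.V = LinearMap.id := by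
      rw [← LinearMap.rTensor_id, ← sum_chainProj R n]
      exact (map_sum (LinearMap.rTensorHom M.1.V) _ _).symm
    exact (LinearMap.congr_fun this w).symm.trans
      ((LinearMap.sum_apply _ _ _).trans (Finset.sum_eq_zero fun x _ => hw x))

variable (G P) in
/-- The Euler–Poincaré formula for the chain complex of `P`. -/
lemma sum_cls_chainRep [Finite P] :
    ∑ n ∈ Finset.range (Nat.card P + 1),
      (-1 : ℤ) ^ n • G0.cls ⟨chainRep R G P n, finite_chains R n⟩ =
    steinberg R G P + G0.cls (trivialRep R G) := by
  have h := sum_cls_complex (chainComplex R G P) (fun n => finite_chains R n) (Nat.card P)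
  have hX : Limits.IsZero ((chainComplex R G P).X (Nat.card P)) := by
    have : IsEmpty (Chain P (Nat.card P)) := ⟨fun s => (chain_lt_card s).false⟩
    exact (Rep.isZero_iff _ _ _).2 (inferInstance : Subsingleton (Chain P (Nat.card P) →₀ R))
  rw [G0.cls_of_isZero (M := ⟨(chainComplex R G P).cycles (Nat.card P), _⟩)
    (Limits.IsZero.of_mono ((chainComplex R G P).iCycles _) hX), smul_zero, add_zero] at h
  rw [steinberg, sub_add_cancel]
  exact h

variable (G) in
lemma tensorHom_steinberg_add_cls_mem [Finite G] [Finite P]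
    (rep : MulAction.orbitRel.Quotient G P → P)
    (hrep : ∀ c, (Quotient.mk'' (rep c) : MulAction.orbitRel.Quotient G P) = c)
    (M : FinRep R G) :
    G0.tensorHom M (steinberg R G P) + G0.cls M ∈ G0.sumInd R G rep := by
  have h : G0.cls M = G0.tensorHom M (G0.cls (trivialRep R G)) :=
    (G0.cls_congr (tensorTrivialIso M)).symm
  rw [h, ← map_add, ← sum_cls_chainRep, map_sum]
  refine AddSubgroup.sum_mem _ fun n _ => ?_
  rw [map_zsmul]
  exact AddSubgroup.zsmul_mem _ (cls_tensor_chainRep_mem R rep hrep M n) _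

/-! ### Homology in degree zero -/

/-- The vertex `x` as a `0`-chain. -/
def vertex (x : P) : Chain P 0 := ⟨fun _ => x, Subsingleton.strictMono (α := Fin 1) _⟩

omit [MulAction G P] [CovariantClass G P (· • ·) (· ≤ ·)] in
lemma eq_vertex (s : Chain P 0) : s = vertex (s.1 0) :=
  Subtype.ext (funext fun i => congrArg s.1 (Subsingleton.elim (α := Fin 1) i 0))

/-- The edge `x < y` as a `1`-chain. -/
def edge {x y : P} (h : x < y) : Chain P 1 :=
  ⟨![x, y], Fin.strictMono_iff_lt_succ.2 fun i => by
    obtain rfl := Subsingleton.elim i 0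
    exact h⟩

lemma boundaryLin_edge {x y : P} (h : x < y) :
    boundaryLin R 0 (Finsupp.single (edge h) 1) =
      Finsupp.single (vertex y) 1 - Finsupp.single (vertex x) (1 : R) := by
  have h0 : (edge h).face 0 = vertex y := eq_vertex _
  have h1 : (edge h).face 1 = vertex x := eq_vertex _
  rw [boundaryLin_single, Fin.sum_univ_two, h0, h1]
  simp [sub_eq_add_neg]

/-- The linear map underlying the augmentation. -/
def augmentationLin : (Chain P 0 →₀ R) →ₗ[R] ULift.{v} R :=
  Finsupp.linearCombination R fun _ => ULift.up 1

lemma augmentationLin_single (s : Chain P 0) (r : R) :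
    augmentationLin R (Finsupp.single s r) = ULift.up r := by
  rw [augmentationLin, Finsupp.linearCombination_single]
  exact ULift.ext _ _ (mul_one _)

lemma augmentationLin_down (c : Chain P 0 →₀ R) :
    (augmentationLin R c).down = ∑ s ∈ c.support, c s := by
  rw [augmentationLin, Finsupp.linearCombination_apply]
  refine (map_sum (ULift.moduleEquiv : ULift.{v} R ≃ₗ[R] R) _ _).trans ?_
  exact Finset.sum_congr rfl fun s _ => mul_one _

variable (G P) in
/-- The augmentation `C₀(P; R) ⟶ R`. -/
def augmentation : chainRep R G P 0 ⟶ (trivialRep R G).1 :=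
  Rep.ofHom (ρ := chainAction R G P 0) (σ := (trivialRep R G).1.ρ)
    ⟨augmentationLin R, fun g => by
      ext1 s
      ext1
      change augmentationLin R (Finsupp.mapDomain (g • ·) (Finsupp.single s 1)) =
        augmentationLin R (Finsupp.single s 1)
      rw [Finsupp.mapDomain_single, augmentationLin_single, augmentationLin_single]⟩

/-- If `P` is connected, any two vertices differ by a boundary. -/
lemma vertex_sub_mem_range [IsConnected P] (x y : P) :
    Finsupp.single (vertex x) 1 - Finsupp.single (vertex y) (1 : R) ∈
      LinearMap.range (boundaryLin R (P := P) 0) := by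
  have step {x y : P} (h : x ≤ y) :
      Finsupp.single (vertex y) 1 - Finsupp.single (vertex x) (1 : R) ∈
        LinearMap.range (boundaryLin R (P := P) 0) := by
    rcases h.eq_or_lt with rfl | h
    · simp
    · exact ⟨_, boundaryLin_edge R h⟩
  refine induct_on_objects {x : P |
    Finsupp.single (vertex x) 1 - Finsupp.single (vertex y) (1 : R) ∈
      LinearMap.range (boundaryLin R (P := P) 0)} (j₀ := y)
    (by simpa using ⟨0, map_zero _⟩) (fun {a b} f => ?_) x
  have := step (leOfHom f)
  constructor
  · exact fun h => by simpa using add_mem this h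
  · exact fun h => by simpa using sub_mem h this

lemma exact_boundary_augmentation [IsConnected P] :
    Function.Exact (boundary R G P 0).hom (augmentation R G P).hom := by
  intro (c : Chain P 0 →₀ R)
  change augmentationLin R c = 0 ↔
    c ∈ LinearMap.range (boundaryLin R (P := P) 0)
  constructor
  · intro hc
    obtain ⟨y⟩ : Nonempty P := inferInstance
    -- The coefficients of `c` add up to zero, so multiples of a fixed vertex `y` may be subtracted.
    have h : c =
        ∑ s ∈ c.support, c s • (Finsupp.single s 1 - Finsupp.single (vertex y) (1 : R)) := by
      have hc' : ∑ s ∈ c.support, c s = 0 := by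
        rw [← augmentationLin_down, hc]
        rfl
      simp_rw [smul_sub, Finset.sum_sub_distrib, ← Finset.sum_smul, hc', zero_smul, sub_zero,
        Finsupp.smul_single_one]
      exact c.sum_single.symm
    rw [h]
    refine Submodule.sum_mem _ fun s _ => Submodule.smul_mem _ _ ?_
    rw [eq_vertex s]
    exact vertex_sub_mem_range R _ y
  · rintro ⟨d, rfl⟩
    have : augmentationLin R ∘ₗ boundaryLin R (P := P) 0 = 0 := by
      ext1 s
      ext1
      change augmentationLin R (boundaryLin R 0 (Finsupp.single s 1)) = 0
      rw [boundaryLin_single, Fin.sum_univ_two]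
      simp [augmentationLin_single]
    exact congr($this d)

variable (G P) in
/-- `H₀(P; R) ≅ R` if `P` is connected. -/
lemma nonempty_homologyZero_iso [IsConnected P] :
    Nonempty (homology R G P 0 ≅ (trivialRep R G).1) := by
  have hd : (chainComplex R G P).d 1 0 = boundary R G P 0 := 
    ChainComplex.of_d (chainRep R G P) (boundary R G P) 0
  have hw : boundary R G P 0 ≫ augmentation R G P = 0 := by
    apply Rep.hom_ext
    apply Representation.IntertwiningMap.toLinearMap_injective
    exact (exact_boundary_augmentation R (G := G) (P := P)).linearMap_comp_eq_zero
  have hex : (ShortComplex.mk (boundary R G P 0) (augmentation R G P) hw).Exact :=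
    (rep_exact_iff _).2 (exact_boundary_augmentation R)
  have hepi : Epi (augmentation R G P) := (Rep.epi_iff_surjective _).2 fun r => by
    obtain ⟨y⟩ : Nonempty P := inferInstance
    exact ⟨(Finsupp.single (vertex y) r.down : Chain P 0 →₀ R), augmentationLin_single R _ _⟩
  have hcok := (chainComplex R G P).opcyclesIsCokernel 1 0 (by simp)
  have key : ∀ d : chainRep R G P 1 ⟶ chainRep R G P 0, d = boundary R G P 0 →
      ∃ w : d ≫ augmentation R G P = 0, (ShortComplex.mk d (augmentation R G P) w).Exact := by
    rintro _ rfl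
    exact ⟨hw, hex⟩
  obtain ⟨w, hex'⟩ := key _ hd
  have : Epi (ShortComplex.mk _ (augmentation R G P) w).g := hepi
  exact ⟨(chainComplex R G P).isoHomologyι₀ ≪≫
    hcok.coconePointUniqueUpToIso hex'.gIsCokernel⟩

end Chains

/-! ### Passage to the stable Grothendieck group -/

section Stable

variable (R : Type u) [Field R] (G : Type v) [Group G]

/-- The quotient map `G₀(R[G]) → G₀ˢᵗ(R[G])`. -/
def G0.toStable : G0 R G →+ stG0 R G :=
  QuotientAddGroup.map _ _ (AddMonoidHom.id _) <|
    AddSubgroup.closure_mono Set.subset_union_left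

lemma G0.toStable_surjective : Function.Surjective (G0.toStable R G) := by
  rintro ⟨a⟩
  exact ⟨QuotientAddGroup.mk' _ a, rfl⟩

variable {R G}

lemma G0.toStable_cls (M : FinRep R G) : G0.toStable R G (G0.cls M) = stG0.cls M := rfl

lemma G0.eq_top_of_cls_mem (S : AddSubgroup (G0 R G)) (h : ∀ M, G0.cls M ∈ S) : S = ⊤ := by
  refine eq_top_iff.2 ?_
  rintro ⟨a⟩ -
  change QuotientAddGroup.mk' _ a ∈ S
  induction a using FreeAbelianGroup.induction_on with
  | zero => exact zero_mem S
  | of M => exact h M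
  | neg M hM => exact neg_mem hM
  | add a b ha hb => exact add_mem ha hb

/-- A projective module is stably isomorphic to zero, its identity factoring through itself. -/
lemma stG0.cls_of_projective {M : FinRep R G} (hM : Projective M.1) : stG0.cls M = 0 := by
  have hZ : Limits.IsZero (Rep.trivial R G PUnit.{max u v + 1}) :=
    (Rep.isZero_iff _ _ _).2 inferInstance
  let Z : FinRep R G := ⟨Rep.trivial R G PUnit.{max u v + 1}, inferInstance⟩
  have hiso : StableIso M Z :=
    ⟨0, 0, ⟨M, -𝟙 _, 𝟙 _, hM, by simp⟩, ⟨Z, 0, 0, hZ.projective, hZ.eq_of_src _ _⟩⟩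
  have h : QuotientAddGroup.mk' (AddSubgroup.closure (exactRelations R G ∪ stableRelations R G))
      (FreeAbelianGroup.of M - FreeAbelianGroup.of Z) = 0 :=
    (QuotientAddGroup.eq_zero_iff _).2 (AddSubgroup.subset_closure (Or.inr ⟨M, Z, hiso, rfl⟩))
  rw [map_sub] at h
  refine (sub_eq_zero.1 h).trans ?_
  change G0.toStable R G (G0.cls Z) = 0
  rw [G0.cls_of_isZero (M := Z) hZ, map_zero]

lemma G0.toStable_eq_zero {a : G0 R G} (ha : a ∈ virtualProjective R G) :
    G0.toStable R G a = 0 := by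
  have : virtualProjective R G ≤ (G0.toStable R G).ker := by
    refine (AddSubgroup.closure_le _).2 ?_
    rintro _ ⟨M, hM, rfl⟩
    exact stG0.cls_of_projective hM
  exact this ha

lemma G0.toStable_mem_sumInd [Finite G] {ι P : Type v} [MulAction G P] (x : ι → P) {a : G0 R G}
    (ha : a ∈ G0.sumInd R G x) : G0.toStable R G a ∈ stG0.sumInd R G x := by
  have : G0.sumInd R G x ≤ (stG0.sumInd R G x).comap (G0.toStable R G) := by
    refine iSup_le fun c => ?_
    rintro _ ⟨⟨b⟩, rfl⟩
    exact AddSubgroup.mem_iSup_of_mem c ⟨G0.toStable _ _ (QuotientAddGroup.mk' _ b), rfl⟩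
  exact this ha

lemma stG0.eq_top_of_cls_mem (S : AddSubgroup (stG0 R G)) (h : ∀ M, stG0.cls M ∈ S) : S = ⊤ := by
  have := G0.eq_top_of_cls_mem (S.comap (G0.toStable R G)) h
  refine eq_top_iff.2 fun a _ => ?_
  obtain ⟨a, rfl⟩ := G0.toStable_surjective R G a
  exact (this ▸ AddSubgroup.mem_top a : a ∈ S.comap (G0.toStable R G))

end Stable

/-- If `P` is connected with vanishing higher homology, then `St_P(G) = [H₀(P; R)] - [R] = 0`. -/
lemma steinberg_eq_zero {R : Type u} [Field R] {G : Type v} [Group G]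
    {P : Type v} [PartialOrder P] [Finite P] [MulAction G P]
    [CovariantClass G P (· • ·) (· ≤ ·)] [IsConnected P]
    (h : ∀ n : ℕ, 0 < n → Limits.IsZero (homology R G P n)) : steinberg R G P = 0 := by
  obtain ⟨e⟩ := nonempty_homologyZero_iso R G P
  have : 0 < Nat.card P := Nat.card_pos
  rw [steinberg, Finset.sum_eq_single_of_mem 0 (Finset.mem_range.2 this)]
  · rw [pow_zero, one_smul, sub_eq_zero]
    exact G0.cls_congr e
  · intro n _ hn
    rw [G0.cls_of_isZero (M := ⟨homology R G P n, _⟩) (h n (Nat.pos_of_ne_zero hn)), smul_zero]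

/-! ### Generation by induced modules -/

section SumInd

variable {R : Type u} [Field R] {G : Type v} [Group G] [Finite G]
  {P : Type v} [PartialOrder P] [Finite P] [MulAction G P] [CovariantClass G P (· • ·) (· ≤ ·)]
  (rep : MulAction.orbitRel.Quotient G P → P)
  (hrep : ∀ c, (Quotient.mk'' (rep c) : MulAction.orbitRel.Quotient G P) = c)

include hrep

theorem G0.sumInd_eq_top (h : steinberg R G P = 0) : G0.sumInd R G rep = ⊤ := by
  refine G0.eq_top_of_cls_mem _ fun M => ?_
  have hM := tensorHom_steinberg_add_cls_mem R G rep hrep M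
  rwa [h, map_zero, zero_add] at hM

theorem stG0.sumInd_eq_top (h : steinberg R G P ∈ virtualProjective R G) :
    stG0.sumInd R G rep = ⊤ := by
  refine stG0.eq_top_of_cls_mem _ fun M => ?_
  have hM := G0.toStable_mem_sumInd rep (tensorHom_steinberg_add_cls_mem R G rep hrep M)
  rwa [map_add, G0.toStable_eq_zero (G0.tensorHom_mem_virtualProjective M h), zero_add,
    G0.toStable_cls] at hM

end SumInd

end

end FinGPoset

theorem corollary5p6 {R : Type u} [Field R] {G : Type v} [Group G] [Finite G]
    {P : Type v} [PartialOrder P] [Finite P] [MulAction G P]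
    [CovariantClass G P (· • ·) (· ≤ ·)]
    (rep : MulAction.orbitRel.Quotient G P → P)
    (hrep : ∀ c, (Quotient.mk'' (rep c) : MulAction.orbitRel.Quotient G P) = c) :
    (IsConnected P → (∀ n : ℕ, 0 < n → Limits.IsZero (FinGPoset.homology R G P n)) →
      FinGPoset.G0.sumInd R G rep = (⊤ : AddSubgroup (FinGPoset.G0 R G)) ∧
      FinGPoset.stG0.sumInd R G rep = (⊤ : AddSubgroup (FinGPoset.stG0 R G))) ∧
    (FinGPoset.steinberg R G P ∈ FinGPoset.virtualProjective R G →
      FinGPoset.stG0.sumInd R G rep = (⊤ : AddSubgroup (FinGPoset.stG0 R G))) := by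
  refine ⟨fun _ hvan => ?_, FinGPoset.stG0.sumInd_eq_top rep hrep⟩
  have hSt := FinGPoset.steinberg_eq_zero hvan
  exact ⟨FinGPoset.G0.sumInd_eq_top rep hrep hSt,
    FinGPoset.stG0.sumInd_eq_top rep hrep (hSt ▸ zero_mem _)⟩
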